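/- Let $d\in\mathbb N$ and $s\ge 0$ (in particular $s\in(0,1)$). For $u\in L^2(\mathbb R^d)$ let $\hat u$ be the Fourier (Plancherel) transform, scaled as $\hat u(\omega)=(2\pi)^{-d}\int_{\mathbb R^d}u(x)e^{-i\omega\cdot x}\,dx$, and for $r\ge 0$ put $$|u|_{H^r}=\Big((2\pi)^d\int_{\mathbb R^d}|\omega|^{2r}|\hat u(\omega)|^2\,d\omega\Big)^{1/2}.$$ For a bounded set $\Omega\subset\mathbb R^d$ (in particular any bounded domain) let $\widetilde H^t(\Omega)$ be the set of all $u\in H^t(\mathbb R^d)$ with $u=0$ a.e. in $\mathbb R^d\setminus\Omega$. Let $\eta\in C_c^\infty(\mathbb R^d)$ be a standard symmetric mollifier: $\eta\ge 0$, $\eta(-x)=\eta(x)$, $\operatorname{supp}\eta\subset \overline{B_1(0)}$, $\int\eta=1$. Put $\eta_\varepsilon(x)=\varepsilon^{-d}\eta(x/\varepsilon)$ and $u_\varepsilon=\eta_\varepsilon*u$. For a natural number $N\ge1$ let $\Pi_N$ be the sinc interpolation operator $$(\Pi_N v)(x)=\sum_{k\in\mathbb Z^d}v(k/N)\,\varphi(Nx-k),\qquad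 \varphi(x)=\prod_{i=1}^d\frac{\sin(\pi x_i)}{\pi x_i}.$$ Then there are constants $C_{(i)},C_{(ii)}$ that depend only on $d$, $s$ and $\eta$ (not on $\Omega$, $t$, $u$, $\varepsilon$ or $N$) such that for every bounded $\Omega\subset\mathbb R^d$, every $t>s$ and every (real- or complex-valued) $u\in\widetilde H^t(\Omega)$: (i) if $t-s<2$, then for all $\varepsilon>0$ $$|u-u_\varepsilon|_{H^s}\le C_{(i)}\,\varepsilon^{t-s}\,|u|_{H^t};$$ (ii) for every natural number $N\ge 1$ and $\varepsilon=1/N$, the function $u_\varepsilon$ belongs to $C^\infty(\mathbb R^d)\cap L^2(\mathbb R^d)$, the series defining $\Pi_N u_\varepsilon(x)$ converges absolutely for every $x$, and $$|u_\varepsilon-\Pi_N u_\varepsilon|_{H^s}\le C_{(ii)}\,\varepsilon^{t-s}\,|u|_{H^t}.$$ In both estimates the function on the left-hand side lies in $L^2(\mathbb R^d)$. -/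

import Mathlib

open MeasureTheory FourierTransform
open scoped ENNReal NNReal ContDiff Convolution SchwartzMap

namespace SincGalerkin

/-- `d`-dimensional Euclidean space. -/
abbrev Rd (d : ℕ) : Type := EuclideanSpace ℝ (Fin d)

noncomputable section

/-- The Fourier transform on `L²(ℝᵈ)` with the scaling
`û(ξ) = (2π)^{-d} ∫ u(x) e^{-i ξ·x} dx`. Mathlib's `𝓕` has the kernel `e^{-2π i ξ·x}` and no
prefactor, so that `û(ξ) = (2π)^{-d} (𝓕 u)(ξ / 2π)`. -/
def fourierL2 {d : ℕ} (u : Lp (α := Rd d) ℂ 2 volume) (ξ : Rd d) : ℂ :=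
  (((2 * Real.pi) ^ d)⁻¹ : ℝ) • (𝓕 u : Lp (α := Rd d) ℂ 2 volume) ((2 * Real.pi)⁻¹ • ξ)

open scoped Classical in
/-- The fractional seminorm `|u|_{H^s} = ((2π)^d ∫ |ξ|^{2s} |û(ξ)|² dξ)^{1/2}`, with values in
`[0, ∞]`. It is set to `∞` for a function that is not in `L²(ℝᵈ)`, so a finite bound on it includes
the assertion that the function lies in `L²(ℝᵈ)`. -/
def hsSeminorm {d : ℕ} (s : ℝ) (u : Rd d → ℂ) : ℝ≥0∞ :=
  if hu : MemLp u 2 volume then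
    (ENNReal.ofReal ((2 * Real.pi) ^ d) *
      ∫⁻ ξ : Rd d, ENNReal.ofReal (‖ξ‖ ^ (2 * s)) * ‖fourierL2 (hu.toLp u) ξ‖ₑ ^ 2) ^ (1 / 2 : ℝ)
  else ∞

/-- `u ∈ H^t(ℝᵈ)`: `u` is square integrable and, as a tempered distribution, belongs to the
`L²`-based Sobolev space of order `t`. -/
def MemH {d : ℕ} (t : ℝ) (u : Rd d → ℂ) : Prop :=
  ∃ hu : MemLp u 2 volume,
    TemperedDistribution.MemSobolev t 2 ((hu.toLp u : Lp (α := Rd d) ℂ 2 volume) : 𝓢'(Rd d, ℂ))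

/-- `u ∈ H̃^t(Ω)`: `u ∈ H^t(ℝᵈ)` and `u = 0` almost everywhere in `ℝᵈ ∖ Ω`. -/
def MemHTilde {d : ℕ} (t : ℝ) (Ω : Set (Rd d)) (u : Rd d → ℂ) : Prop :=
  MemH t u ∧ ∀ᵐ x ∂(volume : Measure (Rd d)), x ∉ Ω → u x = 0

/-- A standard (symmetric) mollifier: smooth, nonnegative, even, supported in the unit ball, with
integral one. -/
structure IsStandardMollifier {d : ℕ} (η : Rd d → ℝ) : Prop where
  contDiff : ContDiff ℝ ∞ η
  nonneg : ∀ x, 0 ≤ η x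
  even : ∀ x, η (-x) = η x
  tsupport_subset : tsupport η ⊆ Metric.closedBall 0 1
  integral_eq_one : ∫ x, η x = 1

/-- The rescaled mollifier `η_ε(x) = ε^{-d} η(x / ε)`. -/
def scaledMollifier {d : ℕ} (η : Rd d → ℝ) (ε : ℝ) (x : Rd d) : ℝ :=
  (ε ^ d)⁻¹ * η (ε⁻¹ • x)

/-- The mollification `u_ε = η_ε * u`. -/
def mollify {d : ℕ} (η : Rd d → ℝ) (ε : ℝ) (u : Rd d → ℂ) : Rd d → ℂ :=
  scaledMollifier η ε ⋆[ContinuousLinearMap.lsmul ℝ ℝ, volume] u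

/-- `φ(x) = ∏ᵢ sin(π xᵢ) / (π xᵢ)`; here `Real.sinc y = sin y / y`, with value `1` at `y = 0`. -/
def sincProd {d : ℕ} (x : Rd d) : ℝ := ∏ i, Real.sinc (Real.pi * x i)

/-- The integer lattice point `k ∈ ℤᵈ`, as a point of `ℝᵈ`. -/
def latticePoint {d : ℕ} (k : Fin d → ℤ) : Rd d := WithLp.toLp 2 fun i => (k i : ℝ)

/-- The basis function `φ^N_k(x) = φ(N x - k)`. -/
def sincBasis {d : ℕ} (N : ℕ) (k : Fin d → ℤ) (x : Rd d) : ℝ :=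
  sincProd ((N : ℝ) • x - latticePoint k)

/-- The `k`-th summand `v(k / N) φ^N_k(x)` of the sinc interpolant of `v` at `x`. -/
def sincTerm {d : ℕ} (N : ℕ) (v : Rd d → ℂ) (x : Rd d) (k : Fin d → ℤ) : ℂ :=
  v ((N : ℝ)⁻¹ • latticePoint k) * (sincBasis N k x : ℂ)

/-- The sinc interpolant `(Π_N v)(x) = ∑_{k ∈ ℤᵈ} v(k / N) φ^N_k(x)`. -/
def sincInterp {d : ℕ} (N : ℕ) (v : Rd d → ℂ) (x : Rd d) : ℂ :=
  ∑' k : Fin d → ℤ, sincTerm N v x k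

end

end SincGalerkin

namespace SincGalerkin

noncomputable section

section L2Fourier

variable {V : Type*} [NormedAddCommGroup V] [InnerProductSpace ℝ V] [FiniteDimensional ℝ V]
  [MeasurableSpace V] [BorelSpace V]

lemma locallyIntegrable_fourier {h : V → ℂ} (hi : Integrable h) :
    LocallyIntegrable (𝓕 h) := by
  have : Continuous (𝓕 h) :=
    VectorFourier.fourierIntegral_continuous Real.continuous_fourierChar
      (by exact continuous_inner) hi
  exact this.locallyIntegrable

lemma locallyIntegrable_fourierInv {h : V → ℂ} (hi : Integrable h) :
    LocallyIntegrable (𝓕⁻ h) := by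
  have : Continuous (𝓕⁻ h) := by
    rw [show 𝓕⁻ h = fun x => 𝓕 h (-x) from funext (Real.fourierInv_eq_fourier_neg h)]
    exact (VectorFourier.fourierIntegral_continuous Real.continuous_fourierChar
      (by exact continuous_inner) hi).comp continuous_neg
  exact this.locallyIntegrable

lemma integral_fourier_smul_eq_of_integrable (g : 𝓢(V, ℂ)) {h : V → ℂ} (hi : Integrable h) :
    ∫ x, 𝓕 g x • h x = ∫ x, g x • 𝓕 h x := by
  have := VectorFourier.integral_fourierIntegral_smul_eq_flip (μ := volume) (ν := volume)
    (L := innerₗ V) (f := g) (g := h) Real.continuous_fourierChar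
    continuous_inner g.integrable hi
  rw [flip_innerₗ] at this
  exact this

lemma integral_fourierInv_smul_eq_of_integrable (g : 𝓢(V, ℂ)) {h : V → ℂ} (hi : Integrable h) :
    ∫ x, 𝓕⁻ g x • h x = ∫ x, g x • 𝓕⁻ h x := by
  have h1 := integral_fourier_smul_eq_of_integrable (𝓕⁻ g) (h := fun x => h (-x)) hi.comp_neg
  have h2 : ∀ x, 𝓕 (fun x => h (-x)) x = 𝓕⁻ h x := fun x => by
    rw [Real.fourierInv_eq_fourier_comp_neg]
  have h3 := integral_fourier_smul_eq_of_integrable g (h := fun x => h (-x)) hi.comp_neg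
  simp only [h2] at h3
  rw [← h3, ← integral_neg_eq_self]
  congr 1
  ext x
  simp only [neg_neg, SchwartzMap.fourierInv_coe, SchwartzMap.fourier_coe,
    Real.fourierInv_eq_fourier_neg]

lemma fourier_toLp_ae_eq {h : V → ℂ} (hi : Integrable h) (h2 : MemLp h 2 volume) :
    (𝓕 (h2.toLp h) : Lp (α := V) ℂ 2 volume) =ᵐ[volume] 𝓕 h := by
  refine ae_eq_of_integral_contDiff_smul_eq
    ((Lp.memLp _).locallyIntegrable one_le_two) (locallyIntegrable_fourier hi) fun g gs gc => ?_
  have hg₁ : HasCompactSupport (Complex.ofRealCLM ∘ g) := gc.comp_left rfl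
  have hg₂ : ContDiff ℝ ∞ (Complex.ofRealCLM ∘ g) := by fun_prop
  set G : 𝓢(V, ℂ) := hg₁.toSchwartzMap hg₂
  have hG : ∀ x, G x = (g x : ℂ) := fun x => by simp [G]
  have e := congrArg (fun T : 𝓢'(V, ℂ) => T G) (Lp.fourier_toTemperedDistribution_eq (h2.toLp h))
  simp only [Lp.toTemperedDistribution_apply, TemperedDistribution.fourier_apply] at e
  have e2 : ∫ x, 𝓕 G x • (h2.toLp h) x = ∫ x, 𝓕 G x • h x :=
    integral_congr_ae (by filter_upwards [h2.coeFn_toLp] with x hx; rw [hx])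
  rw [e2, integral_fourier_smul_eq_of_integrable G hi] at e
  simpa [hG] using e.symm

lemma fourierInv_toLp_ae_eq {h : V → ℂ} (hi : Integrable h) (h2 : MemLp h 2 volume) :
    (𝓕⁻ (h2.toLp h) : Lp (α := V) ℂ 2 volume) =ᵐ[volume] 𝓕⁻ h := by
  refine ae_eq_of_integral_contDiff_smul_eq
    ((Lp.memLp _).locallyIntegrable one_le_two) (locallyIntegrable_fourierInv hi) fun g gs gc => ?_
  have hg₁ : HasCompactSupport (Complex.ofRealCLM ∘ g) := gc.comp_left rfl
  have hg₂ : ContDiff ℝ ∞ (Complex.ofRealCLM ∘ g) := by fun_prop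
  set G : 𝓢(V, ℂ) := hg₁.toSchwartzMap hg₂
  have hG : ∀ x, G x = (g x : ℂ) := fun x => by simp [G]
  have e := congrArg (fun T : 𝓢'(V, ℂ) => T G)
    (Lp.fourierInv_toTemperedDistribution_eq (h2.toLp h))
  simp only [Lp.toTemperedDistribution_apply, TemperedDistribution.fourierInv_apply] at e
  have e2 : ∫ x, 𝓕⁻ G x • (h2.toLp h) x = ∫ x, 𝓕⁻ G x • h x :=
    integral_congr_ae (by filter_upwards [h2.coeFn_toLp] with x hx; rw [hx])
  rw [e2, integral_fourierInv_smul_eq_of_integrable G hi] at e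
  simpa [hG] using e.symm

lemma memLp_fourierInv {h : V → ℂ} (hi : Integrable h) (h2 : MemLp h 2 volume) :
    MemLp (𝓕⁻ h) 2 volume :=
  (memLp_congr_ae (fourierInv_toLp_ae_eq hi h2)).1 (Lp.memLp _)

lemma fourier_toLp_fourierInv_ae_eq {h : V → ℂ} (hi : Integrable h) (h2 : MemLp h 2 volume) :
    (𝓕 ((memLp_fourierInv hi h2).toLp (𝓕⁻ h)) : Lp (α := V) ℂ 2 volume) =ᵐ[volume] h := by
  have : (memLp_fourierInv hi h2).toLp (𝓕⁻ h) = 𝓕⁻ (h2.toLp h) := by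
    refine Lp.ext ?_
    exact (MemLp.coeFn_toLp _).trans (fourierInv_toLp_ae_eq hi h2).symm
  rw [this, FourierTransform.fourier_fourierInv_eq]
  exact h2.coeFn_toLp

end L2Fourier

section Seminorm

variable {d : ℕ}

lemma hsSeminorm_congr_ae {r : ℝ} {u v : Rd d → ℂ} (h : u =ᵐ[volume] v) :
    hsSeminorm r u = hsSeminorm r v := by
  unfold hsSeminorm
  by_cases hu : MemLp u 2 volume
  · have hv : MemLp v 2 volume := (memLp_congr_ae h).1 hu
    rw [dif_pos hu, dif_pos hv, MemLp.toLp_congr hu hv h]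
  · have hv : ¬ MemLp v 2 volume := fun hv => hu ((memLp_congr_ae h).2 hv)
    rw [dif_neg hu, dif_neg hv]

lemma lintegral_comp_smul {f : Rd d → ℝ≥0∞} {c : ℝ} (hc : 0 < c) :
    ∫⁻ x, f (c⁻¹ • x) = ENNReal.ofReal (c ^ d) * ∫⁻ x, f x := by
  have hc' : c⁻¹ ≠ 0 := by positivity
  let e : Rd d ≃ᵐ Rd d := (Homeomorph.smulOfNeZero c⁻¹ hc').toMeasurableEquiv
  have h1 := Measure.map_addHaar_smul (volume : Measure (Rd d)) hc'
  have h2 : ∫⁻ x, f (c⁻¹ • x) = ∫⁻ x, f x ∂(Measure.map e volume) :=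
    (lintegral_map_equiv f e).symm
  have h3 : Measure.map e volume = Measure.map (c⁻¹ • ·) (volume : Measure (Rd d)) := rfl
  rw [h2, h3, h1, lintegral_smul_measure]
  simp [abs_of_pos hc]

/-- The seminorm in terms of the frequency variable of Mathlib's Fourier transform. -/
lemma hsSeminorm_eq {r : ℝ} {u h : Rd d → ℂ} (hu : MemLp u 2 volume)
    (hh : (𝓕 (hu.toLp u) : Lp (α := Rd d) ℂ 2 volume) =ᵐ[volume] h) :
    hsSeminorm r u =
      (∫⁻ ξ : Rd d, ENNReal.ofReal ((2 * Real.pi * ‖ξ‖) ^ (2 * r)) * ‖h ξ‖ₑ ^ 2) ^ (1 / 2 : ℝ) := by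
  have hpi : 0 < 2 * Real.pi := by positivity
  have hpd : 0 < (2 * Real.pi) ^ d := by positivity
  have key : (∫⁻ ξ : Rd d, ENNReal.ofReal ((2 * Real.pi * ‖ξ‖) ^ (2 * r)) * ‖h ξ‖ₑ ^ 2) =
      ∫⁻ ξ : Rd d, ENNReal.ofReal ((2 * Real.pi * ‖ξ‖) ^ (2 * r)) *
        ‖(𝓕 (hu.toLp u) : Lp (α := Rd d) ℂ 2 volume) ξ‖ₑ ^ 2 :=
    lintegral_congr_ae (by filter_upwards [hh] with x hx; rw [hx])
  rw [hsSeminorm, dif_pos hu, key]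
  congr 1
  set F : Lp (α := Rd d) ℂ 2 volume := 𝓕 (hu.toLp u)
  have e : ∀ ξ : Rd d, ENNReal.ofReal (‖ξ‖ ^ (2 * r)) * ‖fourierL2 (hu.toLp u) ξ‖ₑ ^ 2 =
      (ENNReal.ofReal (((2 * Real.pi) ^ d)⁻¹)) ^ 2 *
      (fun ζ : Rd d => ENNReal.ofReal ((2 * Real.pi * ‖ζ‖) ^ (2 * r)) * ‖F ζ‖ₑ ^ 2)
        ((2 * Real.pi)⁻¹ • ξ) := by
    intro ξ
    have h1 : 2 * Real.pi * ‖(2 * Real.pi)⁻¹ • ξ‖ = ‖ξ‖ := by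
      rw [norm_smul, Real.norm_of_nonneg (by positivity)]; field_simp
    have h2 : ‖fourierL2 (hu.toLp u) ξ‖ₑ =
        ENNReal.ofReal (((2 * Real.pi) ^ d)⁻¹) * ‖F ((2 * Real.pi)⁻¹ • ξ)‖ₑ := by
      rw [fourierL2, enorm_smul, Real.enorm_of_nonneg (by positivity)]
    simp only [h1, h2]
    ring
  simp_rw [e]
  rw [lintegral_const_mul' _ _ (by finiteness),
    lintegral_comp_smul (f := fun ζ : Rd d =>
      ENNReal.ofReal ((2 * Real.pi * ‖ζ‖) ^ (2 * r)) * ‖F ζ‖ₑ ^ 2) hpi, ← mul_assoc, ← mul_assoc,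
    ← ENNReal.ofReal_pow (by positivity), ← ENNReal.ofReal_mul (by positivity),
    ← ENNReal.ofReal_mul (by positivity)]
  rw [show (2 * Real.pi) ^ d * (((2 * Real.pi) ^ d)⁻¹) ^ 2 * (2 * Real.pi) ^ d = 1 by
    field_simp]
  simp

end Seminorm

section Tiling

variable {d : ℕ}

@[simp]
lemma latticePoint_apply (k : Fin d → ℤ) (i : Fin d) : latticePoint k i = (k i : ℝ) := rfl

lemma latticePoint_neg (k : Fin d → ℤ) : latticePoint (-k) = -latticePoint k := by
  ext i; simp

/-- The half-open cube `∏ᵢ (a, a + c]`. -/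
def cube (d : ℕ) (a c : ℝ) : Set (Rd d) := {x | ∀ i, x i ∈ Set.Ioc a (a + c)}

lemma measurableSet_cube (a c : ℝ) : MeasurableSet (cube d a c) := by
  have : cube d a c = ⋂ i, (fun x : Rd d => x i) ⁻¹' Set.Ioc a (a + c) := by
    ext x; simp [cube]
  rw [this]
  exact MeasurableSet.iInter fun i => measurableSet_Ioc.preimage (by fun_prop)

lemma cube_eq_preimage (a c : ℝ) :
    cube d a c = (WithLp.ofLp : Rd d → Fin d → ℝ) ⁻¹' {y | ∀ i, y i ∈ Set.Ioc a (a + c)} := rfl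

lemma volume_cube (a c : ℝ) : volume (cube d a c) = ENNReal.ofReal c ^ d := by
  have h : {y : Fin d → ℝ | ∀ i, y i ∈ Set.Ioc a (a + c)} =
      Set.pi Set.univ fun _ => Set.Ioc a (a + c) := by ext; simp
  have hm : MeasurableSet (Set.pi Set.univ fun _ : Fin d => Set.Ioc a (a + c)) :=
    MeasurableSet.univ_pi fun _ => measurableSet_Ioc
  rw [cube_eq_preimage, h, (PiLp.volume_preserving_ofLp (Fin d)).measure_preimage
    hm.nullMeasurableSet, Real.volume_pi_Ioc]
  simp

lemma norm_le_of_forall_abs_le {x : Rd d} {M : ℝ} (hM : 0 ≤ M) (h : ∀ i, |x i| ≤ M) :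
    ‖x‖ ≤ √d * M := by
  rw [EuclideanSpace.norm_eq]
  refine Real.sqrt_le_iff.2 ⟨by positivity, ?_⟩
  rw [mul_pow, Real.sq_sqrt (by positivity)]
  calc ∑ i, ‖x i‖ ^ 2 ≤ ∑ _i : Fin d, M ^ 2 := by
        gcongr with i
        exact h i
    _ = d * M ^ 2 := by simp

lemma norm_le_of_mem_cube {a c : ℝ} {x : Rd d} (hx : x ∈ cube d a c) :
    ‖x‖ ≤ √d * (|a| + |a + c|) :=
  norm_le_of_forall_abs_le (by positivity) fun i =>
    (abs_le_max_abs_abs (hx i).1.le (hx i).2).trans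
      (max_le (by linarith [abs_nonneg (a + c)]) (by linarith [abs_nonneg a]))

/-- Translation by the lattice vector `c k`, as a measurable equivalence. -/
def latticeShift (c : ℝ) (k : Fin d → ℤ) : Rd d ≃ᵐ Rd d :=
  MeasurableEquiv.addRight (c • latticePoint k)

lemma latticeShift_apply (c : ℝ) (k : Fin d → ℤ) (x : Rd d) :
    latticeShift c k x = x + c • latticePoint k := rfl

lemma sum_map_cube (a : ℝ) {c : ℝ} (hc : 0 < c) :
    Measure.sum (fun k : Fin d → ℤ => (volume.restrict (cube d a c)).map (latticeShift c k)) =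
      volume := by
  have h1 : ∀ k : Fin d → ℤ, (volume.restrict (cube d a c)).map (latticeShift c k) =
      volume.restrict ((latticeShift c (-k)) ⁻¹' cube d a c) := by
    intro k
    have hm : MeasurePreserving (latticeShift c k) (volume : Measure (Rd d)) volume :=
      measurePreserving_add_right volume (c • latticePoint k)
    have hp := hm.restrict_preimage_emb (latticeShift c k).measurableEmbedding
      ((latticeShift c (-k)) ⁻¹' cube d a c)
    have hs : (latticeShift c k) ⁻¹' ((latticeShift c (-k)) ⁻¹' cube d a c) = cube d a c := by
      ext x
      simp [latticeShift_apply, latticePoint_neg]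
    rw [hs] at hp
    exact hp.map_eq
  have hmem : ∀ (k : Fin d → ℤ) (x : Rd d), x ∈ (latticeShift c (-k)) ⁻¹' cube d a c ↔
      ∀ i, x i + (-k i) • c ∈ Set.Ioc a (a + c) := by
    intro k x
    refine forall_congr' fun i => ?_
    have : (latticeShift c (-k)) x i = x i + (-k i) • c := by
      rw [latticeShift_apply]
      simp [mul_comm]
    rw [this]
  simp_rw [h1]
  rw [← Measure.restrict_iUnion]
  · convert Measure.restrict_univ
    rw [Set.eq_univ_iff_forall]
    intro x
    choose m hm _ using fun i => existsUnique_add_zsmul_mem_Ioc hc (x i) a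
    refine Set.mem_iUnion.2 ⟨-m, (hmem _ _).2 fun i => ?_⟩
    simpa using hm i
  · intro k l hkl
    refine Set.disjoint_left.2 fun x hk hl => hkl ?_
    ext i
    have := (existsUnique_add_zsmul_mem_Ioc hc (x i) a).unique ((hmem _ _).1 hk i)
      ((hmem _ _).1 hl i)
    simpa using this
  · exact fun k => (latticeShift c (-k)).measurable (measurableSet_cube a c)

lemma lintegral_eq_tsum_cube (a : ℝ) {c : ℝ} (hc : 0 < c) (f : Rd d → ℝ≥0∞) :
    ∫⁻ x, f x = ∑' k : Fin d → ℤ, ∫⁻ x in cube d a c, f (x + c • latticePoint k) := by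
  conv_lhs => rw [← sum_map_cube a hc, lintegral_sum_measure]
  simp_rw [lintegral_map_equiv, latticeShift_apply]

lemma hasSum_integral_cube {E : Type*} [NormedAddCommGroup E] [NormedSpace ℝ E] (a : ℝ) {c : ℝ}
    (hc : 0 < c) {f : Rd d → E} (hf : Integrable f) :
    HasSum (fun k : Fin d → ℤ => ∫ x in cube d a c, f (x + c • latticePoint k)) (∫ x, f x) := by
  have := hasSum_integral_measure (f := f) (μ := fun k : Fin d → ℤ =>
    (volume.restrict (cube d a c)).map (latticeShift c k)) (by rwa [sum_map_cube a hc])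
  rw [sum_map_cube a hc] at this
  simpa only [integral_map_equiv, latticeShift_apply] using this

lemma summable_lattice_decay :
    Summable fun k : Fin d → ℤ => ((1 + ‖latticePoint k‖) ^ (d + 1))⁻¹ := by
  set D : ℝ := √d * (|0| + |0 + 1|)
  have hD : 0 ≤ D := by positivity
  have hint : Integrable (fun x : Rd d => ((1 + ‖x‖) ^ (d + 1))⁻¹) := by
    have := integrable_one_add_norm (E := Rd d) (μ := volume) (r := (d + 1 : ℕ)) (by simp)
    refine this.congr (Filter.Eventually.of_forall fun x => ?_)
    simp only [Real.rpow_neg (show (0 : ℝ) ≤ 1 + ‖x‖ by positivity), Real.rpow_natCast]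
  have h := ((hasSum_integral_cube 0 one_pos hint).summable).mul_left ((1 + D) ^ (d + 1))
  refine h.of_nonneg_of_le (fun k => by positivity) fun k => ?_
  have hv : volume.real (cube d 0 1) = 1 := by simp [Measure.real, volume_cube]
  have hI : ((1 + D) ^ (d + 1))⁻¹ * ((1 + ‖latticePoint k‖) ^ (d + 1))⁻¹ ≤
      ∫ x in cube d 0 1, ((1 + ‖x + (1 : ℝ) • latticePoint k‖) ^ (d + 1))⁻¹ := by
    have hc : ∫ x in cube d 0 1, ((1 + D) ^ (d + 1))⁻¹ * ((1 + ‖latticePoint k‖) ^ (d + 1))⁻¹ =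
        ((1 + D) ^ (d + 1))⁻¹ * ((1 + ‖latticePoint k‖) ^ (d + 1))⁻¹ := by
      rw [setIntegral_const, hv, one_smul]
    rw [← hc]
    refine setIntegral_mono_on ?_ ?_ (measurableSet_cube _ _) fun x hx => ?_
    · exact integrableOn_const (by simp [volume_cube])
    · exact (hint.comp_add_right ((1 : ℝ) • latticePoint k)).integrableOn
    · rw [← mul_inv, ← mul_pow]
      gcongr
      have h1 : ‖x‖ ≤ D := norm_le_of_mem_cube hx
      have h2 := norm_add_le x ((1 : ℝ) • latticePoint k)
      rw [one_smul] at h2 ⊢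
      nlinarith [norm_nonneg (latticePoint k), norm_nonneg x]
  rw [← inv_mul_le_iff₀ (by positivity)]
  exact hI

/-- On bounded sets, the lattice translates of a Schwartz function are dominated by a summable
family. -/
lemma exists_summable_bound (f : 𝓢(Rd d, ℂ)) (R : ℝ) :
    ∃ a : (Fin d → ℤ) → ℝ, Summable a ∧ ∀ x, ‖x‖ ≤ R → ∀ k, ‖f (x + latticePoint k)‖ ≤ a k := by
  set C : ℝ := 2 ^ (d + 1) *
    ((Finset.Iic (d + 1, 0)).sup fun m => SchwartzMap.seminorm ℝ m.1 m.2) f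
  have hC : ∀ x, (1 + ‖x‖) ^ (d + 1) * ‖f x‖ ≤ C := fun x => by
    simpa using SchwartzMap.one_add_le_sup_seminorm_apply (𝕜 := ℝ) (m := (d + 1, 0)) le_rfl le_rfl
      f x
  have hC0 : 0 ≤ C := le_trans (by positivity) (hC 0)
  refine ⟨fun k => (C * (1 + R) ^ (d + 1)) * ((1 + ‖latticePoint k‖) ^ (d + 1))⁻¹,
    summable_lattice_decay.mul_left _, fun x hx k => ?_⟩
  simp only [← div_eq_mul_inv]
  rw [le_div_iff₀ (by positivity)]
  have h1 : 1 + ‖latticePoint k‖ ≤ (1 + ‖x + latticePoint k‖) * (1 + R) := by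
    have h2 : ‖latticePoint k‖ ≤ ‖x + latticePoint k‖ + ‖x‖ := by
      simpa using norm_sub_le (x + latticePoint k) x
    nlinarith [norm_nonneg (x + latticePoint k), norm_nonneg x]
  calc ‖f (x + latticePoint k)‖ * (1 + ‖latticePoint k‖) ^ (d + 1)
      ≤ ‖f (x + latticePoint k)‖ * ((1 + ‖x + latticePoint k‖) * (1 + R)) ^ (d + 1) := by gcongr
    _ = ((1 + ‖x + latticePoint k‖) ^ (d + 1) * ‖f (x + latticePoint k)‖) * (1 + R) ^ (d + 1) := by
        rw [mul_pow]; ring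
    _ ≤ C * (1 + R) ^ (d + 1) := by
        gcongr
        · have : 0 ≤ 1 + R := by linarith [norm_nonneg x]
          positivity
        · exact hC _

lemma summable_norm_lattice (f : 𝓢(Rd d, ℂ)) (x : Rd d) :
    Summable fun k => ‖f (x + latticePoint k)‖ := by
  obtain ⟨a, ha, hb⟩ := exists_summable_bound f ‖x‖
  exact ha.of_nonneg_of_le (fun _ => norm_nonneg _) (hb x le_rfl)

end Tiling

section Poisson

variable {d : ℕ}

/-- The sum of a Schwartz function over the translates by the integer lattice. -/
def periodization (f : 𝓢(Rd d, ℂ)) (x : Rd d) : ℂ := ∑' k : Fin d → ℤ, f (x + latticePoint k)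

lemma continuous_periodization (f : 𝓢(Rd d, ℂ)) : Continuous (periodization f) := by
  rw [continuous_iff_continuousAt]
  intro x
  obtain ⟨a, ha, hb⟩ := exists_summable_bound f (‖x‖ + 1)
  have : ContinuousOn (periodization f) (Metric.closedBall 0 (‖x‖ + 1)) :=
    continuousOn_tsum (fun k => by fun_prop) ha fun k y hy => hb y (by simpa using hy) k
  exact this.continuousAt (Metric.closedBall_mem_nhds_of_mem (by simp))

lemma periodization_add (f : 𝓢(Rd d, ℂ)) (x : Rd d) (m : Fin d → ℤ) :
    periodization f (x + latticePoint m) = periodization f x := by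
  unfold periodization
  rw [← (Equiv.addLeft m).tsum_eq fun k => f (x + latticePoint k)]
  congr 1
  ext k
  congr 1
  ext i
  simp [add_assoc]

/-- The projection `ℝᵈ → ℝᵈ / ℤᵈ`. -/
def torusProj (d : ℕ) : C(Fin d → ℝ, UnitAddTorus (Fin d)) where
  toFun y i := (y i : UnitAddCircle)
  continuous_toFun := by fun_prop

lemma isQuotientMap_torusProj (d : ℕ) : Topology.IsQuotientMap (torusProj d) :=
  (IsOpenQuotientMap.piMap fun _ : Fin d =>
    (QuotientAddGroup.isOpenQuotientMap_mk : IsOpenQuotientMap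
      (fun x : ℝ => (x : UnitAddCircle)))).isQuotientMap

lemma exists_lattice_of_torusProj_eq {y z : Fin d → ℝ} (h : torusProj d y = torusProj d z) :
    ∃ k : Fin d → ℤ, WithLp.toLp 2 z = (WithLp.toLp 2 y : Rd d) + latticePoint k := by
  have : ∀ i, ∃ n : ℤ, z i = y i + n := fun i => by
    have hi : (y i : UnitAddCircle) = z i := congrFun h i
    obtain ⟨n, hn⟩ := AddSubgroup.mem_zmultiples_iff.1 (QuotientAddGroup.eq.1 hi)
    exact ⟨n, by simp at hn; linarith⟩
  choose k hk using this
  exact ⟨k, by ext i; simp [hk]⟩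

/-- The periodization of a Schwartz function, as a function on `ℝᵈ` with the product topology. -/
def periodizationPi (f : 𝓢(Rd d, ℂ)) : C(Fin d → ℝ, ℂ) :=
  ⟨fun y => periodization f (WithLp.toLp 2 y),
    (continuous_periodization f).comp (PiLp.continuous_toLp 2 _)⟩

lemma periodizationPi_factorsThrough (f : 𝓢(Rd d, ℂ)) :
    Function.FactorsThrough (periodizationPi f) (torusProj d) := fun y z h => by
  obtain ⟨k, hk⟩ := exists_lattice_of_torusProj_eq h
  simp [periodizationPi, hk, periodization_add]

/-- The periodization of a Schwartz function, as a function on the torus. -/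
def torusPeriodization (f : 𝓢(Rd d, ℂ)) : C(UnitAddTorus (Fin d), ℂ) :=
  (isQuotientMap_torusProj d).lift (periodizationPi f) (periodizationPi_factorsThrough f)

lemma torusPeriodization_apply (f : 𝓢(Rd d, ℂ)) (y : Fin d → ℝ) :
    torusPeriodization f (torusProj d y) = periodization f (WithLp.toLp 2 y) :=
  DFunLike.congr_fun ((isQuotientMap_torusProj d).lift_comp (periodizationPi f)
    (periodizationPi_factorsThrough f)) y

lemma mFourier_torusProj (m : Fin d → ℤ) (x : Rd d) :
    UnitAddTorus.mFourier m (torusProj d x.ofLp) = (𝐞 (inner ℝ x (latticePoint m)) : ℂ) := by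
  simp only [UnitAddTorus.mFourier, ContinuousMap.coe_mk, torusProj, fourier_coe_apply,
    Real.fourierChar_apply, ← Complex.exp_sum, PiLp.inner_apply]
  congr 1
  simp only [latticePoint_apply, RCLike.inner_apply, conj_trivial]
  push_cast
  rw [Finset.mul_sum, Finset.sum_mul]
  refine Finset.sum_congr rfl fun i _ => ?_
  ring

lemma fourierChar_lattice (k m : Fin d → ℤ) :
    𝐞 (inner ℝ (latticePoint k) (latticePoint m)) = 1 := by
  have : inner ℝ (latticePoint k) (latticePoint m) = ((∑ i, m i * k i : ℤ) : ℝ) := by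
    simp [PiLp.inner_apply]
  rw [this]
  ext
  rw [Real.fourierChar_apply, Circle.coe_one]
  rw [Complex.exp_eq_one_iff]
  exact ⟨∑ i, m i * k i, by push_cast; ring⟩

lemma mFourierCoeff_torusPeriodization (f : 𝓢(Rd d, ℂ)) (m : Fin d → ℤ) :
    UnitAddTorus.mFourierCoeff (torusPeriodization f) m = 𝓕 f (latticePoint m) := by
  set F : Rd d → ℂ := fun x => 𝐞 (-inner ℝ x (latticePoint m)) • f x
  have hF : Integrable F := by
    simpa [F] using (Real.fourierIntegral_convergent_iff (latticePoint m)).2 f.integrable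
  have hper : ∀ x k, F (x + (1 : ℝ) • latticePoint k) =
      𝐞 (-inner ℝ x (latticePoint m)) • f (x + latticePoint k) := by
    intro x k
    have h1 : 𝐞 (-inner ℝ (latticePoint k) (latticePoint m)) = 1 := by
      rw [AddChar.map_neg_eq_inv, fourierChar_lattice, inv_one]
    simp only [F, one_smul, inner_add_left, neg_add, AddChar.map_add_eq_mul, h1, mul_one]
  have hsum := hasSum_integral_cube 0 one_pos hF
  have hsumn := hasSum_integral_cube 0 one_pos hF.norm
  have h2 := integral_tsum_of_summable_integral_norm (μ := volume.restrict (cube d 0 1))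
    (F := fun (k : Fin d → ℤ) x => F (x + (1 : ℝ) • latticePoint k))
    (fun k => (hF.comp_add_right _).integrableOn) hsumn.summable
  have h3 : 𝓕 f (latticePoint m) = ∫ x, F x := rfl
  rw [h3, ← hsum.tsum_eq, h2, UnitAddTorus.mFourierCoeff_eq_integral _ _ (fun _ => 0)]
  have h4 := (PiLp.volume_preserving_ofLp (Fin d)).setIntegral_preimage_emb
    (MeasurableEquiv.toLp 2 (Fin d → ℝ)).symm.measurableEmbedding
    (fun y => UnitAddTorus.mFourier (-m) (torusProj d y) • torusPeriodization f (torusProj d y))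
    {y | ∀ i, y i ∈ Set.Ioc (0 : ℝ) (0 + 1)}
  refine h4.symm.trans ?_
  refine integral_congr_ae (Filter.Eventually.of_forall fun x => ?_)
  simp only [hper]
  rw [mFourier_torusProj, torusPeriodization_apply, latticePoint_neg, inner_neg_right]
  simp only [Circle.smul_def, tsum_mul_left, smul_eq_mul]
  rfl

/-- The Poisson summation formula for Schwartz functions on `ℝᵈ`. -/
theorem hasSum_poisson (f : 𝓢(Rd d, ℂ)) (x : Rd d) :
    HasSum (fun m : Fin d → ℤ => 𝓕 f (latticePoint m) * (𝐞 (inner ℝ x (latticePoint m)) : ℂ))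
      (∑' k : Fin d → ℤ, f (x + latticePoint k)) := by
  have hs : Summable (UnitAddTorus.mFourierCoeff (torusPeriodization f)) := by
    rw [funext (mFourierCoeff_torusPeriodization f)]
    simpa using (summable_norm_lattice (𝓕 f) 0).of_norm
  have := UnitAddTorus.hasSum_mFourier_series_apply_of_summable hs (torusProj d x.ofLp)
  simpa only [torusPeriodization_apply, mFourierCoeff_torusPeriodization, mFourier_torusProj,
    smul_eq_mul, WithLp.toLp_ofLp, periodization] using this

end Poisson

section Mollifier

variable {d : ℕ} {η : Rd d → ℝ}

namespace IsStandardMollifier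

lemma hasCompactSupport (hη : IsStandardMollifier η) : HasCompactSupport η :=
  (isCompact_closedBall 0 1).of_isClosed_subset (isClosed_tsupport η) hη.tsupport_subset

lemma hasCompactSupport_ofReal (hη : IsStandardMollifier η) :
    HasCompactSupport fun x => (η x : ℂ) :=
  hη.hasCompactSupport.comp_left (g := fun y : ℝ => (y : ℂ)) (by simp)

lemma contDiff_ofReal (hη : IsStandardMollifier η) : ContDiff ℝ ∞ fun x => (η x : ℂ) :=
  Complex.ofRealCLM.contDiff.comp hη.contDiff

/-- A standard mollifier as a complex Schwartz function. -/
def toSchwartz (hη : IsStandardMollifier η) : 𝓢(Rd d, ℂ) :=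
  hη.hasCompactSupport_ofReal.toSchwartzMap hη.contDiff_ofReal

lemma fourier_toSchwartz (hη : IsStandardMollifier η) (ζ : Rd d) :
    𝓕 hη.toSchwartz ζ = 𝓕 (fun x => (η x : ℂ)) ζ := by
  rw [SchwartzMap.fourier_coe]
  congr 1

lemma integrable (hη : IsStandardMollifier η) : Integrable η :=
  hη.contDiff.continuous.integrable_of_hasCompactSupport hη.hasCompactSupport

lemma norm_fourier_le_one (hη : IsStandardMollifier η) (ζ : Rd d) :
    ‖𝓕 (fun x => (η x : ℂ)) ζ‖ ≤ 1 := by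
  refine (VectorFourier.norm_fourierIntegral_le_integral_norm _ _ _ _ _).trans_eq ?_
  rw [← hη.integral_eq_one]
  congr 1
  ext x
  simp [abs_of_nonneg (hη.nonneg x)]

lemma eq_zero_of_one_lt_norm (hη : IsStandardMollifier η) {x : Rd d} (hx : 1 < ‖x‖) : η x = 0 := by
  by_contra h
  have := hη.tsupport_subset (subset_tsupport η h)
  rw [mem_closedBall_zero_iff] at this
  linarith

lemma norm_one_sub_fourier_le (hη : IsStandardMollifier η) (ζ : Rd d) :
    ‖1 - 𝓕 (fun x => (η x : ℂ)) ζ‖ ≤ (2 * Real.pi * ‖ζ‖) ^ 2 / 2 := by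
  set F : Rd d → ℂ := fun x => (𝐞 (-inner ℝ x ζ) : ℂ) * (η x : ℂ)
  have hηc : Integrable fun x => (η x : ℂ) := hη.integrable.ofReal
  have hF : Integrable F := by
    have := (Real.fourierIntegral_convergent_iff ζ).2 hηc
    simpa [F, Circle.smul_def] using this
  have e1 : 𝓕 (fun x => (η x : ℂ)) ζ = ∫ x, F x := rfl
  have e2 : 𝓕 (fun x => (η x : ℂ)) ζ = ∫ x, F (-x) := by rw [integral_neg_eq_self, e1]
  have e3 : (1 : ℂ) = ∫ x, (η x : ℂ) := by rw [integral_complex_ofReal, hη.integral_eq_one]; simp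
  have key : (2 : ℂ) * (1 - 𝓕 (fun x => (η x : ℂ)) ζ) =
      ∫ x, (2 * (η x : ℂ) - (F x + F (-x))) := by
    have hFF : Integrable fun x => F x + F (-x) := hF.add hF.comp_neg
    rw [integral_sub (hηc.const_mul 2) hFF, integral_add hF hF.comp_neg,
      integral_const_mul, ← e1, ← e2, ← e3]
    ring
  have hb : ∀ x, ‖2 * (η x : ℂ) - (F x + F (-x))‖ ≤ (2 * Real.pi * ‖ζ‖) ^ 2 * η x := by
    intro x
    rcases lt_or_ge 1 ‖x‖ with hx | hx
    · have h0 : η x = 0 := hη.eq_zero_of_one_lt_norm hx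
      simp [F, hη.even, h0]
    · set y : ℝ := 2 * Real.pi * inner ℝ x ζ
      have hy : 2 * (η x : ℂ) - (F x + F (-x)) = ((2 * (1 - Real.cos y) * η x : ℝ) : ℂ) := by
        simp only [F, hη.even, inner_neg_left, neg_neg, Real.fourierChar_apply]
        have : Complex.cos y = (Complex.exp (y * Complex.I) + Complex.exp (-y * Complex.I)) / 2 :=
          rfl
        push_cast
        rw [this]
        simp only [y]
        push_cast
        ring_nf
      have h1 : 1 - Real.cos y ≤ y ^ 2 / 2 := by linarith [Real.one_sub_sq_div_two_le_cos (x := y)]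
      have h2 : |y| ≤ 2 * Real.pi * ‖ζ‖ := by
        rw [abs_mul, abs_of_pos (by positivity : 0 < 2 * Real.pi)]
        have := abs_real_inner_le_norm x ζ
        gcongr
        nlinarith [norm_nonneg ζ]
      have h3 : y ^ 2 ≤ (2 * Real.pi * ‖ζ‖) ^ 2 := sq_le_sq' (abs_le.1 h2).1 (abs_le.1 h2).2
      rw [hy, Complex.norm_real, Real.norm_of_nonneg
        (mul_nonneg (by linarith [Real.cos_le_one y]) (hη.nonneg x))]
      exact mul_le_mul_of_nonneg_right (by linarith) (hη.nonneg x)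
  have h4 : ‖(2 : ℂ) * (1 - 𝓕 (fun x => (η x : ℂ)) ζ)‖ ≤ (2 * Real.pi * ‖ζ‖) ^ 2 := by
    rw [key]
    calc _ ≤ ∫ x, (2 * Real.pi * ‖ζ‖) ^ 2 * η x :=
          norm_integral_le_of_norm_le (hη.integrable.const_mul _) (Filter.Eventually.of_forall hb)
      _ = _ := by rw [integral_const_mul, hη.integral_eq_one, mul_one]
  rw [norm_mul, Complex.norm_two] at h4
  linarith

lemma contDiff_scaled (hη : IsStandardMollifier η) (ε : ℝ) :
    ContDiff ℝ ∞ (scaledMollifier η ε) :=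
  contDiff_const.mul (hη.contDiff.comp (contDiff_const_smul _))

lemma hasCompactSupport_scaled (hη : IsStandardMollifier η) {ε : ℝ} (hε : 0 < ε) :
    HasCompactSupport (scaledMollifier η ε) :=
  (hη.hasCompactSupport.comp_smul (inv_ne_zero hε.ne')).mul_left

end IsStandardMollifier

lemma fourier_scaledMollifier (η : Rd d → ℝ) {ε : ℝ} (hε : 0 < ε) (ξ : Rd d) :
    𝓕 (fun x => (scaledMollifier η ε x : ℂ)) ξ = 𝓕 (fun x => (η x : ℂ)) (ε • ξ) := by
  have h1 := Measure.integral_comp_inv_smul_of_nonneg (volume : Measure (Rd d))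
    (fun y : Rd d => (𝐞 (-inner ℝ y (ε • ξ)) : ℂ) * (η y : ℂ)) hε.le
  have e1 : 𝓕 (fun x => (η x : ℂ)) (ε • ξ) =
      ∫ y : Rd d, (𝐞 (-inner ℝ y (ε • ξ)) : ℂ) * (η y : ℂ) := rfl
  have e2 : 𝓕 (fun x => (scaledMollifier η ε x : ℂ)) ξ =
      ∫ x : Rd d, (𝐞 (-inner ℝ x ξ) : ℂ) * (scaledMollifier η ε x : ℂ) := rfl
  rw [e1, e2]
  have e3 : ∀ x : Rd d, (𝐞 (-inner ℝ x ξ) : ℂ) * (scaledMollifier η ε x : ℂ) =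
      ((ε ^ d)⁻¹ : ℝ) • ((𝐞 (-inner ℝ (ε⁻¹ • x) (ε • ξ)) : ℂ) * (η (ε⁻¹ • x) : ℂ)) := by
    intro x
    rw [real_inner_smul_left, real_inner_smul_right, inv_mul_cancel_left₀ hε.ne']
    simp only [scaledMollifier, Complex.real_smul]
    push_cast
    ring
  simp_rw [e3]
  rw [integral_smul, h1]
  simp only [finrank_euclideanSpace, Fintype.card_fin]
  rw [inv_smul_smul₀ (by positivity)]

lemma mollify_eq_complex (η : Rd d → ℝ) (ε : ℝ) (u : Rd d → ℂ) :
    mollify η ε u =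
      (fun x => (scaledMollifier η ε x : ℂ)) ⋆[ContinuousLinearMap.lsmul ℂ ℂ, volume] u := by
  ext x
  simp [mollify, convolution_def]

lemma mollify_congr_ae (η : Rd d → ℝ) (ε : ℝ) {u v : Rd d → ℂ} (h : u =ᵐ[volume] v) :
    mollify η ε u = mollify η ε v :=
  convolution_congr _ Filter.EventuallyEq.rfl h

lemma fourier_mollify (hη : IsStandardMollifier η) {ε : ℝ} (hε : 0 < ε) {u : Rd d → ℂ}
    (hu : Integrable u) (ξ : Rd d) :
    𝓕 (mollify η ε u) ξ = 𝓕 (fun x => (η x : ℂ)) (ε • ξ) * 𝓕 u ξ := by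
  have hi : Integrable fun x => (scaledMollifier η ε x : ℂ) :=
    ((hη.contDiff_scaled ε).continuous.integrable_of_hasCompactSupport
      (hη.hasCompactSupport_scaled hε)).ofReal
  rw [mollify_eq_complex, Real.fourier_smul_convolution_eq hi hu, fourier_scaledMollifier η hε,
    smul_eq_mul]

lemma contDiff_mollify (hη : IsStandardMollifier η) {ε : ℝ} (hε : 0 < ε) {u : Rd d → ℂ}
    (hu : Integrable u) : ContDiff ℝ ∞ (mollify η ε u) :=
  (hη.hasCompactSupport_scaled hε).contDiff_convolution_left _ (hη.contDiff_scaled ε)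
    hu.locallyIntegrable

lemma hasCompactSupport_mollify (hη : IsStandardMollifier η) {ε : ℝ} (hε : 0 < ε) {u : Rd d → ℂ}
    (hu : HasCompactSupport u) : HasCompactSupport (mollify η ε u) :=
  (hη.hasCompactSupport_scaled hε).convolution _ hu

end Mollifier

section MollificationError

variable {d : ℕ} {η : Rd d → ℝ}

lemma rpow_half_le_of_le_sq_mul {A B K : ℝ≥0∞} (h : A ≤ K ^ 2 * B) :
    A ^ (1 / 2 : ℝ) ≤ K * B ^ (1 / 2 : ℝ) := by
  calc A ^ (1 / 2 : ℝ) ≤ (K ^ 2 * B) ^ (1 / 2 : ℝ) := ENNReal.rpow_le_rpow h (by norm_num)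
    _ = K * B ^ (1 / 2 : ℝ) := by
      rw [ENNReal.mul_rpow_of_nonneg _ _ (by norm_num), ← ENNReal.rpow_natCast,
        ← ENNReal.rpow_mul]
      norm_num

lemma min_two_sq_le_rpow {z θ : ℝ} (hz : 0 ≤ z) (h0 : 0 < θ) (h2 : θ < 2) :
    min 2 (z ^ 2 / 2) ≤ 2 * z ^ θ := by
  rcases le_or_gt z 1 with h | h
  · refine (min_le_right _ _).trans ?_
    have : z ^ (2 : ℝ) ≤ z ^ θ := Real.rpow_le_rpow_of_exponent_ge_of_imp hz h h2.le
      (fun _ => by simp [h0.ne'])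
    rw [Real.rpow_two] at this
    nlinarith [sq_nonneg z]
  · refine (min_le_left _ _).trans ?_
    linarith [Real.one_le_rpow h.le h0.le]

/-- The mollification error in the fractional seminorms. -/
theorem hsSeminorm_sub_mollify_le (hη : IsStandardMollifier η) {s t : ℝ} (hs : 0 ≤ s) (hst : s < t)
    (ht : t - s < 2) {u : Rd d → ℂ} (hi : Integrable u) (h2 : MemLp u 2 volume)
    (hc : HasCompactSupport u) {ε : ℝ} (hε : 0 < ε) :
    hsSeminorm s (u - mollify η ε u) ≤
      2 * ENNReal.ofReal (ε ^ (t - s)) * hsSeminorm t u := by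
  have hvc := (contDiff_mollify hη hε hi).continuous
  have hvs := hasCompactSupport_mollify hη hε hc
  have hvi : Integrable (mollify η ε u) := hvc.integrable_of_hasCompactSupport hvs
  have hv2 : MemLp (mollify η ε u) 2 volume := hvc.memLp_of_hasCompactSupport hvs
  have hF : ∀ ξ, 𝓕 (u - mollify η ε u) ξ = (1 - 𝓕 (fun x => (η x : ℂ)) (ε • ξ)) * 𝓕 u ξ := by
    intro ξ
    have : 𝓕 (u - mollify η ε u) ξ = 𝓕 u ξ - 𝓕 (mollify η ε u) ξ := by
      simp only [Real.fourier_eq, Pi.sub_apply, smul_sub]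
      rw [integral_sub]
      · exact (Real.fourierIntegral_convergent_iff ξ).2 hi
      · exact (Real.fourierIntegral_convergent_iff ξ).2 hvi
    rw [this, fourier_mollify hη hε hi]
    ring
  rw [hsSeminorm_eq (h2.sub hv2) (fourier_toLp_ae_eq (hi.sub hvi) _),
    hsSeminorm_eq h2 (fourier_toLp_ae_eq hi h2)]
  refine rpow_half_le_of_le_sq_mul ?_
  rw [← lintegral_const_mul' _ _ (by finiteness)]
  refine lintegral_mono fun ξ => ?_
  rw [hF]
  set z : ℝ := 2 * Real.pi * ‖ξ‖
  have hz : 0 ≤ z := by positivity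
  have hθ : 0 < t - s := by linarith
  have hεξ : 2 * Real.pi * ‖ε • ξ‖ = ε * z := by
    rw [norm_smul, Real.norm_of_nonneg hε.le]; ring
  have hb : ‖1 - 𝓕 (fun x => (η x : ℂ)) (ε • ξ)‖ ≤ 2 * ε ^ (t - s) * z ^ (t - s) := by
    rw [mul_assoc, ← Real.mul_rpow hε.le hz]
    refine le_trans (le_min ?_ ?_) (min_two_sq_le_rpow (by positivity) hθ ht)
    · refine (norm_sub_le _ _).trans ?_
      have := hη.norm_fourier_le_one (ε • ξ)
      simp only [norm_one]
      linarith
    · rw [← hεξ]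
      exact hη.norm_one_sub_fourier_le _
  have hzt : z ^ (2 * s) * (z ^ (t - s)) ^ 2 = z ^ (2 * t) := by
    rw [← Real.rpow_natCast, ← Real.rpow_mul hz, ← Real.rpow_add_of_nonneg hz (by positivity)
      (by push_cast; positivity)]
    congr 1
    push_cast
    ring
  calc ENNReal.ofReal (z ^ (2 * s)) * ‖(1 - 𝓕 (fun x => (η x : ℂ)) (ε • ξ)) * 𝓕 u ξ‖ₑ ^ 2
      = ENNReal.ofReal (z ^ (2 * s)) * ‖1 - 𝓕 (fun x => (η x : ℂ)) (ε • ξ)‖ₑ ^ 2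
          * ‖𝓕 u ξ‖ₑ ^ 2 := by rw [enorm_mul]; ring
    _ ≤ ENNReal.ofReal (z ^ (2 * s)) * ENNReal.ofReal (2 * ε ^ (t - s) * z ^ (t - s)) ^ 2
          * ‖𝓕 u ξ‖ₑ ^ 2 := by
        gcongr
        rw [← ofReal_norm]
        exact ENNReal.ofReal_le_ofReal hb
    _ = (2 * ENNReal.ofReal (ε ^ (t - s))) ^ 2 *
          (ENNReal.ofReal (z ^ (2 * t)) * ‖𝓕 u ξ‖ₑ ^ 2) := by
        rw [← hzt, ENNReal.ofReal_mul (p := 2 * ε ^ (t - s)) (by positivity),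
          ENNReal.ofReal_mul (p := 2) (by norm_num),
          ENNReal.ofReal_mul (by positivity), ENNReal.ofReal_pow (by positivity)]
        simp only [ENNReal.ofReal_ofNat]
        ring

end MollificationError

section Aliasing

variable {d : ℕ}

lemma finite_lattice_support {v : Rd d → ℂ} (hv : HasCompactSupport v) {N : ℕ} (hN : 0 < N) :
    {k : Fin d → ℤ | v ((N : ℝ)⁻¹ • latticePoint k) ≠ 0}.Finite := by
  obtain ⟨R, hR⟩ := hv.isCompact.isBounded.subset_closedBall 0
  have hN' : (0 : ℝ) < N := by exact_mod_cast hN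
  refine (Set.finite_Icc (fun _ : Fin d => -⌈N * R⌉) fun _ => ⌈N * R⌉).subset fun k hk => ?_
  have h1 : ‖(N : ℝ)⁻¹ • latticePoint k‖ ≤ R := by simpa using hR (subset_tsupport v hk)
  have h2 : ∀ i, |(k i : ℝ)| ≤ N * R := fun i => by
    rw [norm_smul, norm_inv, Real.norm_of_nonneg hN'.le, inv_mul_le_iff₀ hN'] at h1
    exact (PiLp.norm_apply_le (latticePoint k) i).trans h1
  refine ⟨fun i => ?_, fun i => ?_⟩
  · have h3 : -(N * R) ≤ (k i : ℝ) := (abs_le.1 (h2 i)).1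
    have h4 : (-k i : ℝ) ≤ ⌈N * R⌉ := by linarith [Int.le_ceil (N * R)]
    have : -k i ≤ ⌈N * R⌉ := by exact_mod_cast h4
    show -⌈N * R⌉ ≤ k i
    linarith
  · have h4 : (k i : ℝ) ≤ ⌈N * R⌉ := ((abs_le.1 (h2 i)).2).trans (Int.le_ceil _)
    exact_mod_cast h4

lemma schwartz_eq_fourierInv (V : 𝓢(Rd d, ℂ)) (x : Rd d) : V x = 𝓕⁻ (fun ξ => 𝓕 V ξ) x := by
  have h : 𝓕⁻ (𝓕 V) = V := FourierTransform.fourierInv_fourier_eq V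
  calc V x = (𝓕⁻ (𝓕 V) : 𝓢(Rd d, ℂ)) x := by rw [h]
    _ = _ := by rw [SchwartzMap.fourierInv_coe]

lemma fourier_fourier_comp_smul (V : 𝓢(Rd d, ℂ)) {c : ℝ} (hc : 0 < c) (w : Rd d) :
    𝓕 (fun y : Rd d => 𝓕 V (c • y)) w = ((c ^ d)⁻¹ : ℝ) • V (-(c⁻¹ • w)) := by
  have h1 := Measure.integral_comp_smul_of_nonneg (volume : Measure (Rd d))
    (fun z : Rd d => (𝐞 (-inner ℝ z (c⁻¹ • w)) : ℂ) * 𝓕 V z) c (hR := hc.le)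
  have e1 : 𝓕 (fun y : Rd d => 𝓕 V (c • y)) w =
      ∫ y : Rd d, (𝐞 (-inner ℝ (c • y) (c⁻¹ • w)) : ℂ) * 𝓕 V (c • y) := by
    rw [Real.fourier_eq]
    simp only [real_inner_smul_left, real_inner_smul_right, inv_mul_cancel_left₀ hc.ne']
    rfl
  have e2 : V (-(c⁻¹ • w)) = ∫ z : Rd d, (𝐞 (-inner ℝ z (c⁻¹ • w)) : ℂ) * 𝓕 V z := by
    rw [schwartz_eq_fourierInv, Real.fourierInv_eq]
    simp only [inner_neg_right]
    rfl
  rw [e1, h1, e2]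
  simp

/-- Aliasing: the discrete Fourier transform of the samples of `V` on the lattice `c⁻¹ ℤᵈ` is the
periodization of the Fourier transform of `V`. -/
lemma hasSum_aliasing (V : 𝓢(Rd d, ℂ)) {c : ℝ} (hc : 0 < c) (ξ : Rd d) :
    HasSum (fun k : Fin d → ℤ => (((c ^ d)⁻¹ : ℝ) • V (c⁻¹ • latticePoint k)) *
      (𝐞 (-inner ℝ ξ (c⁻¹ • latticePoint k)) : ℂ))
      (∑' k : Fin d → ℤ, 𝓕 V (ξ + c • latticePoint k)) := by
  let e : Rd d ≃L[ℝ] Rd d := ContinuousLinearEquiv.smulLeft (Units.mk0 c hc.ne')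
  let f : 𝓢(Rd d, ℂ) := SchwartzMap.compCLMOfContinuousLinearEquiv ℂ e (𝓕 V)
  have hf : ∀ y, f y = 𝓕 V (c • y) := fun y => rfl
  have h := hasSum_poisson f (c⁻¹ • ξ)
  have e1 : ∀ m : Fin d → ℤ, 𝓕 f (latticePoint m) =
      ((c ^ d)⁻¹ : ℝ) • V (-(c⁻¹ • latticePoint m)) := fun m => by
    rw [← fourier_fourier_comp_smul V hc]; rfl
  simp only [hf, e1, smul_add, smul_inv_smul₀ hc.ne'] at h
  refine ((Equiv.neg (Fin d → ℤ)).hasSum_iff.2 h).congr_fun fun k => ?_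
  simp [latticePoint_neg, real_inner_smul_left, real_inner_smul_right]

lemma summable_norm_shift (V : 𝓢(Rd d, ℂ)) {c : ℝ} (hc : 0 < c) (ξ : Rd d) :
    Summable fun k : Fin d → ℤ => ‖V (ξ + c • latticePoint k)‖ := by
  let e : Rd d ≃L[ℝ] Rd d := ContinuousLinearEquiv.smulLeft (Units.mk0 c hc.ne')
  let f : 𝓢(Rd d, ℂ) := SchwartzMap.compCLMOfContinuousLinearEquiv ℂ e V
  have hf : ∀ y, f y = V (c • y) := fun y => rfl
  have h := summable_norm_lattice f (c⁻¹ • ξ)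
  simpa only [hf, smul_add, smul_inv_smul₀ hc.ne'] using h

lemma integral_fourierChar_Ioc {c : ℝ} (hc : 0 < c) (y : ℝ) :
    ∫ ξ in Set.Ioc (-(c / 2)) (-(c / 2) + c), (𝐞 (ξ * y) : ℂ) =
      ((c * Real.sinc (Real.pi * (c * y)) : ℝ) : ℂ) := by
  rw [← intervalIntegral.integral_of_le (by linarith)]
  rcases eq_or_ne y 0 with rfl | hy
  · simp [Circle.coe_one]
  have hz : (2 * Real.pi * y * Complex.I : ℂ) ≠ 0 := by
    simp [hy, Real.pi_ne_zero]
  have e : ∀ ξ : ℝ, (𝐞 (ξ * y) : ℂ) = Complex.exp ((2 * Real.pi * y * Complex.I) * ξ) := by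
    intro ξ
    rw [Real.fourierChar_apply]
    congr 1
    push_cast
    ring
  simp_rw [e]
  rw [integral_exp_mul_complex hz, Real.sinc_of_ne_zero (by simp [hy, Real.pi_ne_zero, hc.ne'])]
  push_cast
  have hs : Complex.exp (2 * Real.pi * y * Complex.I * (-(c / 2) + c)) -
      Complex.exp (2 * Real.pi * y * Complex.I * (-(c / 2))) =
      2 * Complex.I * Complex.sin (Real.pi * (c * y)) := by
    rw [Complex.sin]
    have h1 : (2 * Real.pi * y * Complex.I * (-(c / 2) + c) : ℂ) =
      Real.pi * (c * y) * Complex.I := by ring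
    have h2 : (2 * Real.pi * y * Complex.I * (-(c / 2)) : ℂ) =
      -(Real.pi * (c * y)) * Complex.I := by ring
    rw [h1, h2]
    linear_combination (Complex.exp (Real.pi * (c * y) * Complex.I) -
      Complex.exp (-(Real.pi * (c * y)) * Complex.I)) * Complex.I_sq
  rw [hs]
  have hy' : (y : ℂ) ≠ 0 := by exact_mod_cast hy
  have hp' : (Real.pi : ℂ) ≠ 0 := by exact_mod_cast Real.pi_ne_zero
  have hc' : (c : ℂ) ≠ 0 := by exact_mod_cast hc.ne'
  field_simp

/-- The inverse Fourier transform of the indicator of a cube is a product of sinc functions. -/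
lemma integral_fourierChar_cube {c : ℝ} (hc : 0 < c) (w : Rd d) :
    ∫ ξ in cube d (-(c / 2)) c, (𝐞 (inner ℝ ξ w) : ℂ) = ((c ^ d * sincProd (c • w) : ℝ) : ℂ) := by
  have h4 := (PiLp.volume_preserving_ofLp (Fin d)).setIntegral_preimage_emb
    (MeasurableEquiv.toLp 2 (Fin d → ℝ)).symm.measurableEmbedding
    (fun y : Fin d → ℝ => ∏ i, (𝐞 (y i * w i) : ℂ))
    {y | ∀ i, y i ∈ Set.Ioc (-(c / 2)) (-(c / 2) + c)}
  have e : ∀ ξ : Rd d, (𝐞 (inner ℝ ξ w) : ℂ) = ∏ i, (𝐞 (ξ i * w i) : ℂ) := by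
    intro ξ
    simp only [Real.fourierChar_apply, ← Complex.exp_sum, PiLp.inner_apply]
    congr 1
    simp only [RCLike.inner_apply, conj_trivial]
    push_cast
    rw [Finset.mul_sum, Finset.sum_mul]
    exact Finset.sum_congr rfl fun i _ => by ring
  simp_rw [e]
  refine h4.trans ?_
  have hset : {y : Fin d → ℝ | ∀ i, y i ∈ Set.Ioc (-(c / 2)) (-(c / 2) + c)} =
      Set.pi Set.univ fun _ => Set.Ioc (-(c / 2)) (-(c / 2) + c) := by ext; simp
  rw [hset, volume_pi, Measure.restrict_pi_pi]
  rw [integral_fintype_prod_eq_prod (𝕜 := ℂ) (fun i (y : ℝ) => (𝐞 (y * w i) : ℂ))]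
  simp_rw [integral_fourierChar_Ioc hc]
  rw [sincProd]
  push_cast
  rw [Finset.prod_mul_distrib]
  simp

/-- The band-limited spectrum of the sinc interpolant of `V`. -/
def interpSpectrum (V : 𝓢(Rd d, ℂ)) (c : ℝ) : Rd d → ℂ :=
  (cube d (-(c / 2)) c).indicator fun ξ => ∑' k : Fin d → ℤ, 𝓕 V (ξ + c • latticePoint k)

lemma aliasing_eq_sum {V : 𝓢(Rd d, ℂ)} {N : ℕ} (hN : 0 < N)
    (S : Finset (Fin d → ℤ)) (hS : ∀ k, k ∉ S → V ((N : ℝ)⁻¹ • latticePoint k) = 0) (ξ : Rd d) :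
    ∑' k : Fin d → ℤ, 𝓕 V (ξ + (N : ℝ) • latticePoint k) =
      ∑ k ∈ S, ((((N : ℝ) ^ d)⁻¹ : ℝ) • V ((N : ℝ)⁻¹ • latticePoint k)) *
        (𝐞 (-inner ℝ ξ ((N : ℝ)⁻¹ • latticePoint k)) : ℂ) := by
  refine (hasSum_aliasing V (c := N) (by exact_mod_cast hN) ξ).unique
    (hasSum_sum_of_ne_finset_zero fun k hk => ?_)
  rw [hS k hk]
  simp

lemma memLp_interpSpectrum {V : 𝓢(Rd d, ℂ)} (hV : HasCompactSupport V) {N : ℕ} (hN : 0 < N)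
    (p : ℝ≥0∞) : MemLp (interpSpectrum V N) p volume := by
  have hfin := finite_lattice_support hV hN
  have hT := aliasing_eq_sum (V := V) hN hfin.toFinset (fun k hk => by simpa using hk)
  unfold interpSpectrum
  rw [memLp_indicator_iff_restrict (measurableSet_cube _ _), funext hT]
  have : IsFiniteMeasure (volume.restrict (cube d (-((N : ℝ) / 2)) N)) :=
    isFiniteMeasure_restrict.2 (by rw [volume_cube]; finiteness)
  refine MemLp.of_bound (C := ∑ k ∈ hfin.toFinset,
    ‖(((N : ℝ) ^ d)⁻¹ : ℝ) • V ((N : ℝ)⁻¹ • latticePoint k)‖) ?_ ?_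
  · refine Continuous.aestronglyMeasurable ?_
    refine continuous_finsetSum _ fun k _ => continuous_const.mul ?_
    exact continuous_subtype_val.comp (Real.continuous_fourierChar.comp (by fun_prop))
  · refine Filter.Eventually.of_forall fun ξ => (norm_sum_le _ _).trans_eq ?_
    refine Finset.sum_congr rfl fun k _ => ?_
    rw [norm_mul, Circle.norm_coe, mul_one]

lemma summable_sincTerm {v : Rd d → ℂ} (hv : HasCompactSupport v) {N : ℕ} (hN : 0 < N)
    (x : Rd d) : Summable (sincTerm N v x) :=
  summable_of_hasFiniteSupport ((finite_lattice_support hv hN).subset fun k hk h0 => hk (by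
    simp [sincTerm, h0]))

/-- The sinc interpolant is the inverse Fourier transform of the band-limited aliased spectrum. -/
lemma fourierInv_interpSpectrum {V : 𝓢(Rd d, ℂ)} (hV : HasCompactSupport V) {N : ℕ} (hN : 0 < N) :
    𝓕⁻ (interpSpectrum V N) = sincInterp N V := by
  ext x
  have hN' : (0 : ℝ) < N := by exact_mod_cast hN
  have hfin := finite_lattice_support hV hN
  have hS : ∀ k, k ∉ hfin.toFinset → V ((N : ℝ)⁻¹ • latticePoint k) = 0 :=
    fun k hk => by simpa using hk
  rw [sincInterp, tsum_eq_sum (s := hfin.toFinset) fun k hk => by simp [sincTerm, hS k hk],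
    Real.fourierInv_eq]
  have e1 : ∀ ξ : Rd d, 𝐞 (inner ℝ ξ x) • interpSpectrum V N ξ =
      (cube d (-((N : ℝ) / 2)) N).indicator (fun ξ => ∑ k ∈ hfin.toFinset,
        ((((N : ℝ) ^ d)⁻¹ : ℝ) • V ((N : ℝ)⁻¹ • latticePoint k)) *
        (𝐞 (inner ℝ ξ (x - (N : ℝ)⁻¹ • latticePoint k)) : ℂ)) ξ := by
    intro ξ
    unfold interpSpectrum
    by_cases hξ : ξ ∈ cube d (-((N : ℝ) / 2)) N
    · rw [Set.indicator_of_mem hξ, Set.indicator_of_mem hξ, aliasing_eq_sum hN _ hS,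
        Finset.smul_sum]
      refine Finset.sum_congr rfl fun k _ => ?_
      rw [inner_sub_right, sub_eq_add_neg, AddChar.map_add_eq_mul, Circle.coe_mul, Circle.smul_def,
        smul_eq_mul]
      ring
    · rw [Set.indicator_of_notMem hξ, Set.indicator_of_notMem hξ, smul_zero]
  simp_rw [e1]
  have : IsFiniteMeasure (volume.restrict (cube d (-((N : ℝ) / 2)) N)) :=
    isFiniteMeasure_restrict.2 (by rw [volume_cube]; finiteness)
  rw [integral_indicator (measurableSet_cube _ _), integral_finsetSum]
  · refine Finset.sum_congr rfl fun k _ => ?_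
    rw [integral_const_mul, integral_fourierChar_cube hN', sincTerm, sincBasis, smul_sub,
      smul_inv_smul₀ hN'.ne', Complex.real_smul]
    have hNc : (N : ℂ) ≠ 0 := by exact_mod_cast hN'.ne'
    push_cast
    rw [mul_mul_mul_comm, mul_comm _ (_ ^ d : ℂ), mul_assoc, mul_inv_cancel_left₀ (pow_ne_zero d hNc)]
  · intro k _
    refine Integrable.const_mul ?_ _
    refine (memLp_one_iff_integrable.1 (MemLp.of_bound (C := 1) ?_ ?_))
    · exact (continuous_subtype_val.comp
        (Real.continuous_fourierChar.comp (by fun_prop))).aestronglyMeasurable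
    · exact Filter.Eventually.of_forall fun ξ => (Circle.norm_coe _).le

/-- The seminorm of the sinc interpolation error, on the frequency side. -/
lemma hsSeminorm_sub_sincInterp {V : 𝓢(Rd d, ℂ)} (hV : HasCompactSupport V) {N : ℕ} (hN : 0 < N)
    (s : ℝ) :
    hsSeminorm s (⇑V - sincInterp N V) =
      (∫⁻ ξ : Rd d, ENNReal.ofReal ((2 * Real.pi * ‖ξ‖) ^ (2 * s)) *
        ‖𝓕 V ξ - interpSpectrum V N ξ‖ₑ ^ 2) ^ (1 / 2 : ℝ) := by
  have hgi : Integrable (interpSpectrum V N) :=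
    memLp_one_iff_integrable.1 (memLp_interpSpectrum hV hN 1)
  have hi : Integrable (fun ξ => 𝓕 V ξ - interpSpectrum V N ξ) := (𝓕 V).integrable.sub hgi
  have h2 : MemLp (fun ξ => 𝓕 V ξ - interpSpectrum V N ξ) 2 volume :=
    ((𝓕 V).memLp 2 volume).sub (memLp_interpSpectrum hV hN 2)
  have e : (⇑V - sincInterp N V : Rd d → ℂ) = 𝓕⁻ (fun ξ => 𝓕 V ξ - interpSpectrum V N ξ) := by
    ext x
    rw [Pi.sub_apply, ← fourierInv_interpSpectrum hV hN, schwartz_eq_fourierInv V]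
    simp only [Real.fourierInv_eq, smul_sub]
    rw [integral_sub]
    · have := (Real.fourierIntegral_convergent_iff (-x)).2 ((𝓕 V).integrable (μ := volume))
      simp only [inner_neg_right, neg_neg] at this
      exact this
    · have := (Real.fourierIntegral_convergent_iff (-x)).2 hgi
      simp only [inner_neg_right, neg_neg] at this
      exact this
  rw [e, hsSeminorm_eq (memLp_fourierInv hi h2) (fourier_toLp_fourierInv_ae_eq hi h2)]

end Aliasing

section InterpolationError

variable {d : ℕ} {η : Rd d → ℝ}

lemma tsum_mul_sq_le {ι : Type*} [Countable ι] (f g : ι → ℝ≥0∞) :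
    (∑' i, f i * g i) ^ 2 ≤ (∑' i, f i ^ 2) * ∑' i, g i ^ 2 := by
  let _ : MeasurableSpace ι := ⊤
  have h := ENNReal.lintegral_mul_le_Lp_mul_Lq (Measure.count : Measure ι)
    Real.HolderConjugate.two_two (f := f) (g := g) (Measurable.of_discrete).aemeasurable
    (Measurable.of_discrete).aemeasurable
  simp only [lintegral_count, Pi.mul_apply, ENNReal.rpow_two] at h
  calc (∑' i, f i * g i) ^ 2
      ≤ ((∑' i, f i ^ 2) ^ (1 / 2 : ℝ) * (∑' i, g i ^ 2) ^ (1 / 2 : ℝ)) ^ 2 := by gcongr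
    _ = _ := by
      rw [mul_pow, ← ENNReal.rpow_natCast, ← ENNReal.rpow_natCast, ← ENNReal.rpow_mul,
        ← ENNReal.rpow_mul]
      norm_num

lemma half_le_norm_of_notMem_cube {c : ℝ} {ξ : Rd d}
    (hξ : ξ ∉ cube d (-(c / 2)) c) : c / 2 ≤ ‖ξ‖ := by
  by_contra h
  push Not at h
  refine hξ fun i => ?_
  have := abs_lt.1 ((PiLp.norm_apply_le ξ i).trans_lt h)
  exact ⟨this.1, by linarith [this.2]⟩

lemma add_lattice_notMem_cube {a c : ℝ} (hc : 0 < c) {ξ : Rd d} (hξ : ξ ∈ cube d a c)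
    {k : Fin d → ℤ} (hk : k ≠ 0) : ξ + c • latticePoint k ∉ cube d a c := by
  intro h
  refine hk (funext fun i => ?_)
  have h1 : ξ i + k i • c ∈ Set.Ioc a (a + c) := by
    simpa [mul_comm] using h i
  have h2 : ξ i + (0 : ℤ) • c ∈ Set.Ioc a (a + c) := by simpa using hξ i
  exact (existsUnique_add_zsmul_mem_Ioc hc (ξ i) a).unique h1 h2

/-- Outside the frequency cube, a weight of order `s` is controlled by one of order `t`. -/
lemma weight_le_of_le {s t c z : ℝ} (hst : s ≤ t) (hc : 0 < c) (hz : c ≤ z) :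
    z ^ (2 * s) ≤ (c⁻¹ ^ (t - s)) ^ 2 * z ^ (2 * t) := by
  have hz0 : 0 < z := hc.trans_le hz
  have e : (c⁻¹ ^ (t - s)) ^ 2 * z ^ (2 * t) = z ^ (2 * s) * ((z / c) ^ (t - s)) ^ 2 := by
    rw [div_eq_mul_inv, Real.mul_rpow hz0.le (by positivity), mul_pow,
      show 2 * t = 2 * s + (t - s) * (2 : ℕ) by push_cast; ring, Real.rpow_add hz0,
      Real.rpow_mul hz0.le (t - s), Real.rpow_natCast]
    ring
  rw [e]
  have h1 : 1 ≤ (z / c) ^ (t - s) :=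
    Real.one_le_rpow ((one_le_div hc).2 hz) (by linarith)
  exact le_mul_of_one_le_right (by positivity) (one_le_pow₀ h1)

/-- The weight of order `s` inside the frequency cube against the weight of order `t` outside. -/
lemma weight_le_mul_weight {s t c z y K : ℝ} (hs : 0 ≤ s) (hst : s ≤ t) (hc : 0 < c) (hK : 0 ≤ K)
    (hy0 : 0 ≤ y) (hy : y ≤ K * c) (hz : c ≤ z) :
    y ^ (2 * s) ≤ K ^ (2 * s) * (c⁻¹ ^ (t - s)) ^ 2 * z ^ (2 * t) :=
  calc y ^ (2 * s) ≤ (K * c) ^ (2 * s) := Real.rpow_le_rpow hy0 hy (by positivity)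
    _ = K ^ (2 * s) * c ^ (2 * s) := Real.mul_rpow hK hc.le
    _ ≤ K ^ (2 * s) * z ^ (2 * s) := by gcongr
    _ ≤ K ^ (2 * s) * ((c⁻¹ ^ (t - s)) ^ 2 * z ^ (2 * t)) := by
        gcongr
        exact weight_le_of_le hst hc hz
    _ = _ := by ring

/-- The squares of the shifted Fourier transform of the mollifier are summable, uniformly on the
unit cube. -/
lemma exists_tsum_fourier_sq_le (hη : IsStandardMollifier η) :
    ∃ A : ℝ≥0, ∀ ζ : Rd d, ‖ζ‖ ≤ √d →
      ∑' k : Fin d → ℤ, ‖𝓕 (fun x => (η x : ℂ)) (ζ + latticePoint k)‖ₑ ^ 2 ≤ A := by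
  obtain ⟨a, ha, hb⟩ := exists_summable_bound (𝓕 hη.toSchwartz) (√d)
  have ha0 : ∀ k, 0 ≤ a k := fun k => (norm_nonneg _).trans (hb 0 (by simp) k)
  refine ⟨(∑' k, a k).toNNReal, fun ζ hζ => ?_⟩
  have : ((∑' k, a k).toNNReal : ℝ≥0∞) = ∑' k, ENNReal.ofReal (a k) :=
    ENNReal.ofReal_tsum_of_nonneg ha0 ha
  rw [this]
  refine ENNReal.tsum_le_tsum fun k => ?_
  have h1 := hη.norm_fourier_le_one (ζ + latticePoint k)
  have h2 := hb ζ hζ k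
  rw [hη.fourier_toSchwartz] at h2
  rw [← ofReal_norm, ← ENNReal.ofReal_pow (norm_nonneg _)]
  refine ENNReal.ofReal_le_ofReal (le_trans ?_ h2)
  nlinarith [norm_nonneg (𝓕 (fun x => (η x : ℂ)) (ζ + latticePoint k))]

/-- The aliasing error inside the frequency cube. -/
lemma enorm_aliasing_sq_le {A : ℝ≥0}
    (hA : ∀ ζ : Rd d, ‖ζ‖ ≤ √d →
      ∑' k : Fin d → ℤ, ‖𝓕 (fun x => (η x : ℂ)) (ζ + latticePoint k)‖ₑ ^ 2 ≤ A)
    {V : 𝓢(Rd d, ℂ)} {U : Rd d → ℂ} {c : ℝ} (hc : 0 < c)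
    (hV : ∀ ξ, 𝓕 V ξ = 𝓕 (fun x => (η x : ℂ)) (c⁻¹ • ξ) * U ξ) {ξ : Rd d}
    (hξ : ξ ∈ cube d (-(c / 2)) c) :
    ‖𝓕 V ξ - interpSpectrum V c ξ‖ₑ ^ 2 ≤
      A * ∑' k : Fin d → ℤ, (if k = 0 then 0 else ‖U (ξ + c • latticePoint k)‖ₑ) ^ 2 := by
  have hsum : Summable fun k : Fin d → ℤ => 𝓕 V (ξ + c • latticePoint k) :=
    (summable_norm_shift (𝓕 V) hc ξ).of_norm
  have h0 : latticePoint (0 : Fin d → ℤ) = 0 := by ext; simp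
  have e1 : 𝓕 V ξ - interpSpectrum V c ξ =
      -∑' k : Fin d → ℤ, if k = 0 then 0 else 𝓕 V (ξ + c • latticePoint k) := by
    rw [interpSpectrum, Set.indicator_of_mem hξ, hsum.tsum_eq_add_tsum_ite 0, h0]
    simp
  have e2 : ∀ k : Fin d → ℤ, ‖if k = 0 then 0 else 𝓕 V (ξ + c • latticePoint k)‖ₑ =
      ‖𝓕 (fun x => (η x : ℂ)) (c⁻¹ • ξ + latticePoint k)‖ₑ *
        (if k = 0 then 0 else ‖U (ξ + c • latticePoint k)‖ₑ) := by
    intro k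
    split_ifs
    · simp
    · rw [hV, enorm_mul, smul_add, inv_smul_smul₀ hc.ne']
  have hζ : ‖c⁻¹ • ξ‖ ≤ √d := by
    have h1 := norm_le_of_mem_cube hξ
    rw [norm_smul, norm_inv, Real.norm_of_nonneg hc.le, inv_mul_le_iff₀ hc]
    have e3 : |-(c / 2)| + |-(c / 2) + c| = c := by
      rw [abs_neg, abs_of_pos (by positivity), show -(c / 2) + c = c / 2 by ring,
        abs_of_pos (by positivity)]
      ring
    rw [e3] at h1
    linarith
  calc ‖𝓕 V ξ - interpSpectrum V c ξ‖ₑ ^ 2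
      ≤ (∑' k : Fin d → ℤ, ‖𝓕 (fun x => (η x : ℂ)) (c⁻¹ • ξ + latticePoint k)‖ₑ *
        (if k = 0 then 0 else ‖U (ξ + c • latticePoint k)‖ₑ)) ^ 2 := by
        rw [e1, enorm_neg, ← tsum_congr e2]
        gcongr
        exact enorm_tsum_le_tsum_enorm
    _ ≤ _ := (tsum_mul_sq_le _ _).trans (mul_le_mul_left (hA _ hζ) _)

/-- The frequency-side form of the sinc interpolation error estimate. -/
lemma lintegral_interpolation_error_le {A : ℝ≥0}
    (hA : ∀ ζ : Rd d, ‖ζ‖ ≤ √d →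
      ∑' k : Fin d → ℤ, ‖𝓕 (fun x => (η x : ℂ)) (ζ + latticePoint k)‖ₑ ^ 2 ≤ A)
    (hη : IsStandardMollifier η) {s t : ℝ} (hs : 0 ≤ s) (hst : s ≤ t)
    {V : 𝓢(Rd d, ℂ)} {U : Rd d → ℂ} (hU : Measurable U) {c : ℝ} (hc : 0 < c)
    (hV : ∀ ξ, 𝓕 V ξ = 𝓕 (fun x => (η x : ℂ)) (c⁻¹ • ξ) * U ξ) :
    ∫⁻ ξ : Rd d, ENNReal.ofReal ((2 * Real.pi * ‖ξ‖) ^ (2 * s)) *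
        ‖𝓕 V ξ - interpSpectrum V c ξ‖ₑ ^ 2 ≤
      (1 + ENNReal.ofReal ((2 * Real.pi * √d) ^ (2 * s)) * A) *
        ENNReal.ofReal (c⁻¹ ^ (t - s)) ^ 2 *
        ∫⁻ ξ : Rd d, ENNReal.ofReal ((2 * Real.pi * ‖ξ‖) ^ (2 * t)) * ‖U ξ‖ₑ ^ 2 := by
  set Q := cube d (-(c / 2)) c
  set G : Rd d → ℝ≥0∞ := fun ξ => ENNReal.ofReal ((2 * Real.pi * ‖ξ‖) ^ (2 * t)) * ‖U ξ‖ₑ ^ 2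
  set E : ℝ≥0∞ := ENNReal.ofReal (c⁻¹ ^ (t - s)) ^ 2 with hE
  set K : ℝ := 2 * Real.pi * √d
  have hE' : E = ENNReal.ofReal ((c⁻¹ ^ (t - s)) ^ 2) := by
    rw [hE, ENNReal.ofReal_pow (by positivity)]
  have hout : ∀ ξ ∉ Q, c ≤ 2 * Real.pi * ‖ξ‖ := fun ξ hξ => by
    have := half_le_norm_of_notMem_cube hξ
    nlinarith [Real.pi_gt_three, norm_nonneg ξ]
  have hin : ∀ ξ ∈ Q, 2 * Real.pi * ‖ξ‖ ≤ K * c := fun ξ hξ => by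
    have h1 := norm_le_of_mem_cube hξ
    have e3 : |-(c / 2)| + |-(c / 2) + c| = c := by
      rw [abs_neg, abs_of_pos (by positivity), show -(c / 2) + c = c / 2 by ring,
        abs_of_pos (by positivity)]
      ring
    rw [e3] at h1
    simp only [K, mul_assoc]
    gcongr
  have h1 : ∫⁻ ξ in Qᶜ, ENNReal.ofReal ((2 * Real.pi * ‖ξ‖) ^ (2 * s)) *
      ‖𝓕 V ξ - interpSpectrum V c ξ‖ₑ ^ 2 ≤ E * ∫⁻ ξ, G ξ := by
    rw [← lintegral_const_mul' _ _ (by finiteness)]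
    refine (setLIntegral_mono' (measurableSet_cube _ _).compl fun ξ hξ => ?_).trans
      (setLIntegral_le_lintegral _ _)
    have hξ' : ξ ∉ Q := hξ
    rw [interpSpectrum, Set.indicator_of_notMem hξ', sub_zero, hV, enorm_mul, mul_pow, hE',
      ← mul_assoc (ENNReal.ofReal _) (ENNReal.ofReal _), ← ENNReal.ofReal_mul (by positivity)]
    have h2 : ‖𝓕 (fun x => (η x : ℂ)) (c⁻¹ • ξ)‖ₑ ^ 2 ≤ 1 := by
      rw [← ofReal_norm]
      exact pow_le_one' (ENNReal.ofReal_le_one.2 (hη.norm_fourier_le_one (c⁻¹ • ξ))) 2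
    calc _ ≤ ENNReal.ofReal ((2 * Real.pi * ‖ξ‖) ^ (2 * s)) * (1 * ‖U ξ‖ₑ ^ 2) := by gcongr
      _ ≤ _ := by
        rw [one_mul]
        gcongr
        exact weight_le_of_le hst hc (hout ξ hξ')
  have h2 : ∫⁻ ξ in Q, ENNReal.ofReal ((2 * Real.pi * ‖ξ‖) ^ (2 * s)) *
      ‖𝓕 V ξ - interpSpectrum V c ξ‖ₑ ^ 2 ≤
        ENNReal.ofReal (K ^ (2 * s)) * A * E * ∫⁻ ξ, G ξ := by
    have hG : ∀ k : Fin d → ℤ, AEMeasurable (fun ξ => G (ξ + c • latticePoint k))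
        (volume.restrict Q) := fun k => by fun_prop
    rw [lintegral_eq_tsum_cube (-(c / 2)) hc G,
      ← lintegral_tsum hG,
      ← lintegral_const_mul' _ _ (by finiteness)]
    refine setLIntegral_mono' (measurableSet_cube _ _) fun ξ hξ => ?_
    calc _ ≤ ENNReal.ofReal ((2 * Real.pi * ‖ξ‖) ^ (2 * s)) * (A * ∑' k : Fin d → ℤ,
          (if k = 0 then 0 else ‖U (ξ + c • latticePoint k)‖ₑ) ^ 2) :=
          mul_le_mul_right (enorm_aliasing_sq_le hA hc hV hξ) _
      _ = A * ∑' k : Fin d → ℤ, ENNReal.ofReal ((2 * Real.pi * ‖ξ‖) ^ (2 * s)) *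
          (if k = 0 then 0 else ‖U (ξ + c • latticePoint k)‖ₑ) ^ 2 := by
          rw [ENNReal.tsum_mul_left]
          ring
      _ ≤ A * ∑' k : Fin d → ℤ, ENNReal.ofReal (K ^ (2 * s)) * E *
          G (ξ + c • latticePoint k) := by
          refine mul_le_mul_right (ENNReal.tsum_le_tsum fun k => ?_) _
          split_ifs with hk
          · simp
          · have hw := weight_le_mul_weight hs hst hc (by positivity) (by positivity) (hin ξ hξ)
              (hout _ (add_lattice_notMem_cube hc hξ hk))
            simp only [G]
            rw [hE', ← mul_assoc, ← ENNReal.ofReal_mul (by positivity),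
              ← ENNReal.ofReal_mul (by positivity)]
            gcongr
      _ = _ := by
          rw [ENNReal.tsum_mul_left]
          ring
  rw [← lintegral_add_compl _ (measurableSet_cube (-(c / 2)) c)]
  refine (add_le_add h2 h1).trans_eq ?_
  ring

/-- The sinc interpolation error of a mollified function in the fractional seminorms. -/
theorem hsSeminorm_mollify_sub_sincInterp_le {A : ℝ≥0}
    (hA : ∀ ζ : Rd d, ‖ζ‖ ≤ √d →
      ∑' k : Fin d → ℤ, ‖𝓕 (fun x => (η x : ℂ)) (ζ + latticePoint k)‖ₑ ^ 2 ≤ A)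
    (hη : IsStandardMollifier η) {s t : ℝ} (hs : 0 ≤ s) (hst : s ≤ t) {u : Rd d → ℂ}
    (hi : Integrable u) (h2 : MemLp u 2 volume) (hc : HasCompactSupport u) {N : ℕ} (hN : 0 < N) :
    hsSeminorm s (mollify η (1 / N) u - sincInterp N (mollify η (1 / N) u)) ≤
      (NNReal.sqrt (1 + ((2 * Real.pi * √d) ^ (2 * s)).toNNReal * A) : ℝ≥0) *
        ENNReal.ofReal ((1 / N : ℝ) ^ (t - s)) * hsSeminorm t u := by
  have hN' : (0 : ℝ) < N := by exact_mod_cast hN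
  have hε : (0 : ℝ) < 1 / N := by positivity
  have hvs := hasCompactSupport_mollify hη hε hc
  let V : 𝓢(Rd d, ℂ) := hvs.toSchwartzMap (contDiff_mollify hη hε hi)
  have hV : (V : Rd d → ℂ) = mollify η (1 / N) u := rfl
  have hVF : ∀ ξ, 𝓕 V ξ = 𝓕 (fun x => (η x : ℂ)) ((N : ℝ)⁻¹ • ξ) * 𝓕 u ξ := fun ξ => by
    rw [SchwartzMap.fourier_coe, hV, fourier_mollify hη hε hi, one_div]
  have hU : Measurable (𝓕 u) :=
    (VectorFourier.fourierIntegral_continuous Real.continuous_fourierChar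
      (by exact continuous_inner) hi : Continuous (𝓕 u)).measurable
  rw [← hV, hsSeminorm_sub_sincInterp (V := V) (by rwa [hV]) hN,
    hsSeminorm_eq h2 (fourier_toLp_ae_eq hi h2)]
  refine rpow_half_le_of_le_sq_mul ((lintegral_interpolation_error_le hA hη hs hst hU hN'
    hVF).trans_eq ?_)
  rw [mul_pow, ← ENNReal.coe_pow, NNReal.sq_sqrt, one_div]
  push_cast
  rfl

lemma MemHTilde.exists_compactSupport {t : ℝ} {Ω : Set (Rd d)} (hΩ : Bornology.IsBounded Ω)
    {u : Rd d → ℂ} (hu : MemHTilde t Ω u) :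
    ∃ w : Rd d → ℂ, u =ᵐ[volume] w ∧ Integrable w ∧ MemLp w 2 volume ∧ HasCompactSupport w := by
  obtain ⟨⟨hu2, -⟩, hu0⟩ := hu
  obtain ⟨R, hR⟩ := hΩ.subset_closedBall 0
  set B : Set (Rd d) := Metric.closedBall 0 R
  have hB : MeasurableSet B := measurableSet_closedBall
  have h2 : MemLp (B.indicator u) 2 volume := hu2.indicator hB
  have : IsFiniteMeasure (volume.restrict B) :=
    isFiniteMeasure_restrict.2 measure_closedBall_lt_top.ne
  refine ⟨B.indicator u, ?_, ?_, h2, ?_⟩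
  · filter_upwards [hu0] with x hx
    by_cases hxB : x ∈ B
    · rw [Set.indicator_of_mem hxB]
    · rw [Set.indicator_of_notMem hxB, hx fun h => hxB (hR h)]
  · rw [integrable_indicator_iff hB]
    exact (hu2.restrict B).integrable one_le_two
  · exact HasCompactSupport.intro (isCompact_closedBall 0 R) fun x hx =>
      Set.indicator_of_notMem hx _

end InterpolationError

end

end SincGalerkin

theorem mainTheorem8 (d : ℕ) (s : ℝ) (hs : 0 ≤ s) (η : SincGalerkin.Rd d → ℝ)
    (hη : SincGalerkin.IsStandardMollifier η) :
    ∃ C₁ C₂ : ℝ≥0, ∀ (Ω : Set (SincGalerkin.Rd d)), Bornology.IsBounded Ω →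
      ∀ t : ℝ, s < t → ∀ u : SincGalerkin.Rd d → ℂ, SincGalerkin.MemHTilde t Ω u →
        (t - s < 2 → ∀ ε : ℝ, 0 < ε →
          SincGalerkin.hsSeminorm s (u - SincGalerkin.mollify η ε u)
            ≤ C₁ * ENNReal.ofReal (ε ^ (t - s)) * SincGalerkin.hsSeminorm t u) ∧
        (∀ N : ℕ, 0 < N → ∀ ε : ℝ, ε = 1 / (N : ℝ) →
          (ContDiff ℝ ∞ (SincGalerkin.mollify η ε u) ∧
            MemLp (SincGalerkin.mollify η ε u) 2 volume ∧
            ∀ x, Summable (SincGalerkin.sincTerm N (SincGalerkin.mollify η ε u) x)) ∧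
          SincGalerkin.hsSeminorm s
              (SincGalerkin.mollify η ε u - SincGalerkin.sincInterp N (SincGalerkin.mollify η ε u))
            ≤ C₂ * ENNReal.ofReal (ε ^ (t - s)) * SincGalerkin.hsSeminorm t u) := by
  obtain ⟨A, hA⟩ := SincGalerkin.exists_tsum_fourier_sq_le hη
  refine ⟨2, NNReal.sqrt (1 + ((2 * Real.pi * √d) ^ (2 * s)).toNNReal * A),
    fun Ω hΩ t hst u hu => ?_⟩
  obtain ⟨w, huw, hi, h2, hc⟩ := hu.exists_compactSupport hΩ
  have hm : ∀ ε, SincGalerkin.mollify η ε u = SincGalerkin.mollify η ε w := fun ε =>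
    SincGalerkin.mollify_congr_ae η ε huw
  rw [SincGalerkin.hsSeminorm_congr_ae (r := t) huw]
  refine ⟨fun ht ε hε => ?_, fun N hN ε hεN => ?_⟩
  · rw [hm, SincGalerkin.hsSeminorm_congr_ae (huw.sub Filter.EventuallyEq.rfl)]
    exact SincGalerkin.hsSeminorm_sub_mollify_le hη hs hst ht hi h2 hc hε
  · subst hεN
    rw [hm]
    have hε : (0 : ℝ) < 1 / N := by positivity
    have hv := SincGalerkin.contDiff_mollify hη hε hi
    have hvs := SincGalerkin.hasCompactSupport_mollify hη hε hc
    exact ⟨⟨hv, hv.continuous.memLp_of_hasCompactSupport hvs,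
      SincGalerkin.summable_sincTerm hvs hN⟩,
      SincGalerkin.hsSeminorm_mollify_sub_sincInterp_le hA hη hs hst.le hi h2 hc hN⟩
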